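/- Let $d\ge 0$, $m\ge 0$, $E=\{0,1,\dots,m\}$, and let $F^0,\dots,F^m:\mathbb{R}^d\to\mathbb{R}^d$ be bounded $C^\infty$ vector fields with flows $\Phi^i(t,x)$. Let $M\subset\mathbb{R}^d$ be compact with $\Phi^i(t,x)\in M$ for all $i\in E$, $x\in M$, $t\ge 0$. Let $x\mapsto Q(x)=(Q(x,i,j))_{i,j\in E}$ be continuous on $\mathbb{R}^d$ such that every $Q(x)$ is an irreducible aperiodic Markov transition matrix (some power of $Q(x)$ has only positive entries), and let $\lambda>0$. Consider the Markov chain $(\tilde Z_n)_n=(\tilde X_n,\tilde Y_n)_n$ on $M\times E$ defined as follows: given $\tilde Z_n=(x,i)$, let $U_{n+1}$ be an independent exponentially distributed time with rate $\lambda$, put $\tilde X_{n+1}=\Phi^{i}(U_{n+1},x)$, and let $\tilde Y_{n+1}=j$ with probability $Q(\tilde X_{n+1},i,j)$. Let $S\subset\mathbb{R}^{m+1}$ be the canonical basis, $\mathrm{co}(S)$ the unit simplex, and let $V=S$ or $V=\mathrm{co}(S)$. For a measurable control $v:[0,\infty)\to V$ let $\varphi(t,x,v)$, $t\ge0$, be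 the solution of $\dot x(t)=\sum_{i=0}^m v_i(t)F^i(x(t))$, $x(0)=x$. For $T>0$ let $\mathcal{O}^+_{\le T}(x)$ be the set of all points $\varphi(t,x,v)$ with $t\in[0,T]$ and $v$ a control, let $\mathcal{O}^-_{\le T}(x)=\{y: x\in\mathcal{O}^+_{\le T}(y)\}$, and let $\mathcal{O}^+(x)=\bigcup_{T>0}\mathcal{O}^+_{\le T}(x)$. A control set is a nonempty set $D\subset\mathbb{R}^d$ which is maximal with the properties that (i) for every $x\in D$ there is a control $v$ with $\varphi(t,x,v)\in D$ for all $t\ge0$, and (ii) $D\subset\mathrm{cl}\,\mathcal{O}^+(x)$ for every $x\in D$. A control set $C$ is an invariant control set if $\mathrm{cl}\,C=\mathrm{cl}\,\mathcal{O}^+(x)$ for all $x\in C$. The system is locally accessible on $C$ if for all $x\in C$, all $T>0$ and all neighborhoods $N$ of $x$ both $\mathrm{int}\,\mathcal{O}^+_{\le T}(x)\cap N$ and $\mathrm{int}\,\mathcal{O}^-_{\le T}(x)\cap N$ are nonempty. Let $\mu$ be a probability measure on $M\times E$ that is invariant for $(\tilde Z_n)_n$, and let $C$ be a compact invariant control set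 such that the system is locally accessible on $C$. If $\mathrm{supp}\,\mu\cap(C\times E)\neq\emptyset$, then $C\times E\subset\mathrm{supp}\,\mu$ and, in particular, $\mu(C\times E)>0$. -/

import Mathlib

open MeasureTheory ProbabilityTheory Set Topology
open scoped ContDiff ENNReal

namespace PDMP

/-- The state space `ℝᵈ` of the continuous component. -/
abbrev Space (d : ℕ) := EuclideanSpace ℝ (Fin d)

/-! ### The deterministic control system `ẋ = ∑ᵢ vᵢ(t) Fⁱ(x)` -/

section Control

variable {d m : ℕ}

/-- The set `S` of vectors of the canonical basis of `ℝᵐ⁺¹`. -/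
def vertexSet (m : ℕ) : Set (Fin (m + 1) → ℝ) :=
  {v | ∑ i, v i = 1 ∧ ∀ i, v i = 0 ∨ v i = 1}

/-- Admissible control functions: measurable functions on `ℝ₊` with values in the control
range `V`. (The values at negative times are irrelevant.) -/
def IsControl (V : Set (Fin (m + 1) → ℝ)) (v : ℝ → Fin (m + 1) → ℝ) : Prop :=
  Measurable v ∧ ∀ t, 0 ≤ t → v t ∈ V

/-- `γ = φ(·, x, v)` is the (Carathéodory) solution on `ℝ₊` of
`ẋ(t) = ∑ᵢ vᵢ(t) Fⁱ(x(t))`, `x(0) = x`. -/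
def IsTrajectory (F : Fin (m + 1) → Space d → Space d) (x : Space d)
    (v : ℝ → Fin (m + 1) → ℝ) (γ : ℝ → Space d) : Prop :=
  ContinuousOn γ (Ici 0) ∧
    ∀ t, 0 ≤ t → γ t = x + ∫ s in (0 : ℝ)..t, ∑ i, v s i • F i (γ s)

/-- The set `𝒪⁺_{≤ T}(x)` of points reachable from `x` up to time `T`. -/
def reachLE (F : Fin (m + 1) → Space d → Space d) (V : Set (Fin (m + 1) → ℝ))
    (T : ℝ) (x : Space d) : Set (Space d) :=
  {y | ∃ v γ, IsControl V v ∧ IsTrajectory F x v γ ∧ ∃ t ∈ Icc 0 T, γ t = y}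

/-- The set `𝒪⁻_{≤ T}(x)` of points controllable to `x` up to time `T`. -/
def controlLE (F : Fin (m + 1) → Space d → Space d) (V : Set (Fin (m + 1) → ℝ))
    (T : ℝ) (x : Space d) : Set (Space d) :=
  {y | x ∈ reachLE F V T y}

/-- The reachable set `𝒪⁺(x)`. -/
def reach (F : Fin (m + 1) → Space d → Space d) (V : Set (Fin (m + 1) → ℝ))
    (x : Space d) : Set (Space d) :=
  ⋃ T ∈ Ioi (0 : ℝ), reachLE F V T x

/-- Local accessibility in the point `x`. -/
def LocallyAccessibleAt (F : Fin (m + 1) → Space d → Space d)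
    (V : Set (Fin (m + 1) → ℝ)) (x : Space d) : Prop :=
  ∀ T, 0 < T → ∀ N ∈ 𝓝 x,
    (interior (reachLE F V T x) ∩ N).Nonempty ∧ (interior (controlLE F V T x) ∩ N).Nonempty

/-- The conditions (i) (controlled invariance) and (ii) (approximate controllability) in the
definition of control sets. -/
def IsPreControlSet (F : Fin (m + 1) → Space d → Space d)
    (V : Set (Fin (m + 1) → ℝ)) (D : Set (Space d)) : Prop :=
  (∀ x ∈ D, ∃ v γ, IsControl V v ∧ IsTrajectory F x v γ ∧ ∀ t, 0 ≤ t → γ t ∈ D) ∧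
    ∀ x ∈ D, D ⊆ closure (reach F V x)

/-- Control sets: nonempty sets that are maximal with the properties (i) and (ii). -/
def IsControlSet (F : Fin (m + 1) → Space d → Space d)
    (V : Set (Fin (m + 1) → ℝ)) (D : Set (Space d)) : Prop :=
  D.Nonempty ∧ IsPreControlSet F V D ∧
    ∀ D' : Set (Space d), IsPreControlSet F V D' → D ⊆ D' → D' = D

/-- Invariant control sets. -/
def IsInvariantControlSet (F : Fin (m + 1) → Space d → Space d)
    (V : Set (Fin (m + 1) → ℝ)) (C : Set (Space d)) : Prop :=
  IsControlSet F V C ∧ ∀ x ∈ C, closure C = closure (reach F V x)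

end Control

/-! ### The discrete-time process -/

section Chain

variable {d m : ℕ}

open Classical in
/-- The flow `Φ(t, x)` of a vector field `f`: the value at time `t` of the solution of `ẋ = f(x)`,
`x(0) = x`. For a bounded smooth vector field a unique global solution exists; the value `x`
in the other case is a mere convention. -/
noncomputable def flow (f : Space d → Space d) (t : ℝ) (x : Space d) : Space d :=
  if h : ∃ γ : ℝ → Space d, γ 0 = x ∧ IsIntegralCurve γ (fun _ => f) then h.choose t else x

/-- `q` is a Markov transition matrix that is irreducible and aperiodic. -/
def IsIrreducibleAperiodic (q : Matrix (Fin (m + 1)) (Fin (m + 1)) ℝ) : Prop :=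
  (∀ i j, 0 ≤ q i j) ∧ (∀ i, ∑ j, q i j = 1) ∧
    ∃ n : ℕ, 0 < n ∧ ∀ i j, 0 < (q ^ n) i j

/-- The one-step transition probability `P((x, i), A)` of the discrete-time process: from
`(x, i)`, follow the flow of `Fⁱ` for an exponentially distributed time `U` with rate `lam`, arrive
at `x' = Φⁱ(U, x)`, and then choose the new index `j` with probability `Q(x', i, j)`. -/
noncomputable def transitionProb (F : Fin (m + 1) → Space d → Space d)
    (Q : Space d → Matrix (Fin (m + 1)) (Fin (m + 1)) ℝ) (lam : ℝ)
    (z : Space d × Fin (m + 1)) (A : Set (Space d × Fin (m + 1))) : ℝ≥0∞ :=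
  ∫⁻ t, ∑ j, ENNReal.ofReal (Q (flow (F z.2) t z.1) z.2 j) *
    A.indicator 1 (flow (F z.2) t z.1, j) ∂(expMeasure lam)

/-- `μ` is an invariant measure of the discrete-time process. -/
def IsInvariantMeasure (F : Fin (m + 1) → Space d → Space d)
    (Q : Space d → Matrix (Fin (m + 1)) (Fin (m + 1)) ℝ) (lam : ℝ)
    (μ : Measure (Space d × Fin (m + 1))) : Prop :=
  ∀ A : Set (Space d × Fin (m + 1)), MeasurableSet A →
    ∫⁻ z, transitionProb F Q lam z A ∂μ = μ A

end Chain

end PDMP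

namespace PDMP

/-! The support of `μ` is closed, and invariance makes it absorb every move the chain can make. If
`(x, i)` lies in it and `Q(Φⁱ(t,x), i, j) > 0`, then `(Φⁱ(t,x), j)` lies in it too, because
exponential times charge every short interval after `t` (`mem_support_of_flow`). Taking `t = 0` and
chaining positive entries of `Q x` reaches all indices over the same point, so the support is a
product with the full index set.

Its slice is thus a closed set, forward invariant under each single flow. A Nagumo-type argument
(`IsTrajectory.mem_of_flow_mem`: Gronwall for the squared distance to the set) extends this to all
measurable controls, convexified or not. The slice therefore contains `closure (reach F V x)`, which
is `C`. Local accessibility gives `C` interior points; these lie in the support, so `C` has positive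
mass. -/

variable {d m : ℕ}

/-! ### Global flows of bounded smooth fields -/

theorem exists_lipschitzOnWith_closedBall {f : Space d → Space d} (hf : ContDiff ℝ ∞ f)
    (x : Space d) (r : ℝ) : ∃ K, LipschitzOnWith K f (Metric.closedBall x r) :=
  hf.contDiffOn.exists_lipschitzOnWith (by simp) (convex_closedBall x r)
    (isCompact_closedBall x r)

theorem norm_sub_le_of_hasDerivAt {f : Space d → Space d} {B : ℝ} (hB : ∀ x, ‖f x‖ ≤ B)
    {γ : ℝ → Space d} {s : Set ℝ} (hs : Convex ℝ s) (hγ : ∀ t ∈ s, HasDerivAt γ (f (γ t)) t)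
    {a b : ℝ} (ha : a ∈ s) (hb : b ∈ s) : ‖γ b - γ a‖ ≤ B * |b - a| :=
  hs.norm_image_sub_le_of_norm_hasDerivWithin_le
    (fun t ht => (hγ t ht).hasDerivWithinAt) (fun t _ => hB (γ t)) ha hb

/-- Speed at most `B` confines a curve to the ball of radius `B * (n + 1)` up to time `n + 1`, so
Picard–Lindelöf applies on each such interval, and uniqueness glues the pieces. This rules out the
default branch of `flow`. -/
theorem exists_isIntegralCurve {f : Space d → Space d} (hf : ContDiff ℝ ∞ f)
    {B : ℝ} (hB : ∀ x, ‖f x‖ ≤ B) (x : Space d) :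
    ∃ γ : ℝ → Space d, γ 0 = x ∧ IsIntegralCurve γ (fun _ => f) := by
  have hB0 : 0 ≤ B := (norm_nonneg _).trans (hB x)
  have local_curve : ∀ n : ℕ, ∃ γ : ℝ → Space d, γ 0 = x ∧
      ∀ t ∈ Ioo (-(n + 1 : ℝ)) (n + 1), HasDerivAt γ (f (γ t)) t := by
    intro n
    have hn : (0 : ℝ) < n + 1 := by positivity
    obtain ⟨K, hK⟩ := exists_lipschitzOnWith_closedBall hf x (B * (n + 1))
    have hP : IsPicardLindelof (fun _ => f) (tmin := -(n + 1 : ℝ)) (tmax := n + 1)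
        ⟨0, by constructor <;> linarith⟩ x ⟨B * (n + 1), by positivity⟩ 0 ⟨B, hB0⟩ K :=
      IsPicardLindelof.of_time_independent (fun y _ => hB y) hK (by
        simp only [sub_zero, zero_sub, neg_neg, max_self, NNReal.coe_zero]
        exact le_rfl)
    obtain ⟨γ, h0, hγ⟩ := hP.exists_eq_forall_mem_Icc_hasDerivWithinAt₀
    exact ⟨γ, h0, fun t ht => (hγ t (Ioo_subset_Icc_self ht)).hasDerivAt (Icc_mem_nhds ht.1 ht.2)⟩
  choose γ h0 hγ using local_curve
  have agree : ∀ k n : ℕ, k ≤ n → EqOn (γ k) (γ n) (Ioo (-(k + 1 : ℝ)) (k + 1)) := by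
    intro k n hkn
    have hkn' : (k : ℝ) ≤ n := by exact_mod_cast hkn
    have hk : (0 : ℝ) < k + 1 := by positivity
    obtain ⟨K, hK⟩ := exists_lipschitzOnWith_closedBall hf x (B * (k + 1))
    have mem : ∀ l : ℕ, k ≤ l → ∀ t ∈ Ioo (-(k + 1 : ℝ)) (k + 1),
        HasDerivAt (γ l) (f (γ l t)) t ∧ γ l t ∈ Metric.closedBall x (B * (k + 1)) := by
      intro l hl t ht
      have hl' : (k : ℝ) ≤ l := by exact_mod_cast hl
      have hsub : Ioo (-(k + 1 : ℝ)) (k + 1) ⊆ Ioo (-(l + 1 : ℝ)) (l + 1) :=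
        Ioo_subset_Ioo (by linarith) (by linarith)
      refine ⟨hγ l t (hsub ht), ?_⟩
      have := norm_sub_le_of_hasDerivAt hB (convex_Ioo _ _) (hγ l)
        (a := 0) (b := t) (hsub ⟨by linarith, hk⟩) (hsub ht)
      rw [h0, sub_zero] at this
      rw [mem_closedBall_iff_norm]
      exact this.trans (mul_le_mul_of_nonneg_left (abs_le.2 ⟨ht.1.le, ht.2.le⟩) hB0)
    exact ODE_solution_unique_of_mem_Ioo (v := fun _ => f) (t₀ := 0) (fun _ _ => hK)
      ⟨by linarith, hk⟩ (mem k le_rfl) (mem n hkn) (by rw [h0, h0])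
  -- The extra `+ 1` in the intervals puts `t` strictly inside the one indexed by `⌈|t|⌉₊`.
  refine ⟨fun t => γ ⌈|t|⌉₊ t, h0 _, fun t => ?_⟩
  have lt_ceil : ∀ s : ℝ, s ∈ Ioo (-((⌈|s|⌉₊ : ℝ) + 1)) ((⌈|s|⌉₊ : ℝ) + 1) := fun s =>
    abs_lt.1 (lt_of_le_of_lt (Nat.le_ceil |s|) (lt_add_one _))
  have key : (fun s => γ ⌈|s|⌉₊ s) =ᶠ[𝓝 t] γ ⌈|t|⌉₊ := by
    filter_upwards [Ioo_mem_nhds (lt_ceil t).1 (lt_ceil t).2] with s hs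
    rcases le_total ⌈|s|⌉₊ ⌈|t|⌉₊ with h | h
    · exact agree _ _ h (lt_ceil s)
    · exact (agree _ _ h hs).symm
  exact (hγ _ t (lt_ceil t)).congr_of_eventuallyEq key

section Flow

variable {f : Space d → Space d} (hf : ContDiff ℝ ∞ f) {B : ℝ} (hB : ∀ x, ‖f x‖ ≤ B)

include hf hB

theorem flow_spec (x : Space d) :
    flow f 0 x = x ∧ ∀ t, HasDerivAt (fun s => flow f s x) (f (flow f t x)) t := by
  have h := exists_isIntegralCurve hf hB x
  have hflow : (fun t => flow f t x) = h.choose := by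
    funext t
    rw [flow, dif_pos h]
  refine ⟨(congrFun hflow 0).trans h.choose_spec.1, fun t => ?_⟩
  rw [hflow, show flow f t x = h.choose t from congrFun hflow t]
  exact h.choose_spec.2 t

theorem norm_flow_sub_le (x : Space d) (s t : ℝ) :
    ‖flow f t x - flow f s x‖ ≤ B * |t - s| :=
  norm_sub_le_of_hasDerivAt hB convex_univ (γ := fun s => flow f s x)
    (fun t _ => (flow_spec hf hB x).2 t) (mem_univ s) (mem_univ t)

theorem exists_dist_flow_le (x : Space d) (T : ℝ) :
    ∃ K : ℝ, 0 ≤ K ∧ ∀ t ∈ Icc 0 T, ∀ y ∈ Metric.closedBall x 1,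
      dist (flow f t y) (flow f t x) ≤ dist y x * K := by
  obtain ⟨K, hK⟩ := exists_lipschitzOnWith_closedBall hf x (1 + B * T)
  have hB0 : 0 ≤ B := (norm_nonneg _).trans (hB x)
  refine ⟨Real.exp (K * T), (Real.exp_pos _).le, fun t ht y hy => ?_⟩
  have mem : ∀ z ∈ Metric.closedBall x 1, ∀ s ∈ Ico 0 T,
      flow f s z ∈ Metric.closedBall x (1 + B * T) := by
    intro z hz s hs
    have h1 := norm_flow_sub_le hf hB z 0 s
    rw [(flow_spec hf hB z).1, sub_zero, abs_of_nonneg hs.1, ← dist_eq_norm] at h1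
    have h2 : B * s ≤ B * T := mul_le_mul_of_nonneg_left hs.2.le hB0
    have h3 := dist_triangle (flow f s z) z x
    rw [Metric.mem_closedBall] at hz ⊢
    linarith
  have cont : ∀ z, ContinuousOn (fun s => flow f s z) (Icc 0 T) := fun z =>
    HasDerivAt.continuousOn (fun s _ => (flow_spec hf hB z).2 s)
  have h := dist_le_of_trajectories_ODE_of_mem (v := fun _ => f)
    (f := fun s => flow f s y) (g := fun s => flow f s x) (δ := dist y x)
    (fun _ _ => hK) (cont y)
    (fun s _ => ((flow_spec hf hB y).2 s).hasDerivWithinAt) (mem y hy) (cont x)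
    (fun s _ => ((flow_spec hf hB x).2 s).hasDerivWithinAt)
    (mem x (Metric.mem_closedBall_self zero_le_one))
    (by simp only [(flow_spec hf hB y).1, (flow_spec hf hB x).1, le_refl]) t ht
  refine h.trans ?_
  rw [sub_zero]
  have := ht.2
  gcongr

/-- Joint continuity in time and starting point, with a window to the right of `t` so that all its
times are positive even when `t = 0`. -/
theorem exists_forall_flow_mem {x : Space d} {t : ℝ} (ht : 0 ≤ t) {N : Set (Space d)}
    (hN : N ∈ 𝓝 (flow f t x)) :
    ∃ δ > 0, ∀ s ∈ Ioo t (t + δ), ∀ y ∈ Metric.ball x δ, flow f s y ∈ N := by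
  obtain ⟨ε, hε, hεN⟩ := Metric.mem_nhds_iff.1 hN
  obtain ⟨K, hK0, hK⟩ := exists_dist_flow_le hf hB x (t + 1)
  have hB0 : 0 ≤ B := (norm_nonneg _).trans (hB x)
  have hKB : 0 < K + B + 1 := by linarith
  refine ⟨min 1 (ε / (K + B + 1)), by positivity, fun s hs y hy => hεN ?_⟩
  set δ := min 1 (ε / (K + B + 1)) with hδ
  have hδ0 : 0 < δ := by positivity
  have hδ1 : δ ≤ 1 := min_le_left _ _
  have hδε : δ * (K + B + 1) ≤ ε := (le_div_iff₀ hKB).1 (min_le_right _ _)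
  have hy' : dist y x < δ := hy
  have h1 := hK s ⟨ht.trans hs.1.le, by linarith [hs.2]⟩ y
    (Metric.mem_closedBall.2 (hy'.le.trans hδ1))
  have h2 := norm_flow_sub_le hf hB x t s
  rw [abs_of_pos (sub_pos.2 hs.1), ← dist_eq_norm] at h2
  have h3 := dist_triangle (flow f s y) (flow f s x) (flow f t x)
  have h4 : dist y x * K ≤ δ * K := by gcongr
  have h5 : B * (s - t) ≤ B * δ := mul_le_mul_of_nonneg_left (by linarith [hs.2]) hB0
  rw [Metric.mem_ball]
  nlinarith

end Flow

theorem expMeasure_Ioo_pos {lam : ℝ} (hlam : 0 < lam) {a b : ℝ} (ha : 0 ≤ a) (hab : a < b) :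
    0 < expMeasure lam (Ioo a b) := by
  rw [pos_iff_ne_zero, expMeasure, gammaMeasure, Ne, withDensity_apply_eq_zero
    (show Measurable (gammaPDF 1 lam) from (measurable_gammaPDFReal 1 lam).ennreal_ofReal)]
  intro h
  have hsub : Ioo a b ⊆ {x | gammaPDF 1 lam x ≠ 0} ∩ Ioo a b := fun x hx =>
    ⟨(ENNReal.ofReal_pos.2 (gammaPDFReal_pos one_pos hlam (ha.trans_lt hx.1))).ne', hx⟩
  have := measure_mono_null hsub h
  rw [Real.volume_Ioo, ENNReal.ofReal_eq_zero] at this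
  linarith

/-- For `t ≥ 0`, the squared distance from `y` to `η t` is smallest at `t = 0`, so its derivative
there is nonnegative. -/
theorem inner_le_zero_of_infDist_eq_dist {A : Set (Space d)} {y p w : Space d} {η : ℝ → Space d}
    (hp : Metric.infDist y A = dist y p) (hη : HasDerivAt η w 0) (hη0 : η 0 = p)
    (hηA : ∀ t, 0 ≤ t → η t ∈ A) : inner ℝ (y - p) w ≤ 0 := by
  have hd : HasDerivAt (fun t => ‖y - η t‖ ^ 2) (2 * inner ℝ (y - p) (-w)) 0 := by
    have := (hη.const_sub y).norm_sq
    rwa [hη0] at this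
  have hlim := hasDerivWithinAt_iff_tendsto_slope'
    self_notMem_Ioi |>.1 (hd.hasDerivWithinAt (s := Ioi 0))
  have h0 : 0 ≤ 2 * inner ℝ (y - p) (-w) := by
    refine ge_of_tendsto hlim ?_
    filter_upwards [self_mem_nhdsWithin] with t ht
    have ht' : (0 : ℝ) < t := ht
    have h1 : ‖y - p‖ ≤ ‖y - η t‖ := by
      rw [← dist_eq_norm, ← dist_eq_norm, ← hp]
      exact Metric.infDist_le_dist_of_mem (hηA t ht'.le)
    rw [slope_def_field, hη0, sub_zero]
    have h2 : ‖y - p‖ ^ 2 ≤ ‖y - η t‖ ^ 2 := by gcongr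
    exact div_nonneg (sub_nonneg.2 h2) ht'.le
  rw [inner_neg_right] at h0
  linarith

theorem IsControl.mem_stdSimplex {V : Set (Fin (m + 1) → ℝ)}
    (hV : V = vertexSet m ∨ V = stdSimplex ℝ (Fin (m + 1))) {v : ℝ → Fin (m + 1) → ℝ}
    (hv : IsControl V v) {t : ℝ} (ht : 0 ≤ t) : v t ∈ stdSimplex ℝ (Fin (m + 1)) := by
  have h := hv.2 t ht
  rcases hV with rfl | rfl
  · refine ⟨fun i => ?_, h.1⟩
    rcases h.2 i with h0 | h0 <;> rw [h0]
    exact zero_le_one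
  · exact h

/-! ### Invariance of closed sets under controlled trajectories -/

section Trajectory

variable {F : Fin (m + 1) → Space d → Space d} {x : Space d} {v : ℝ → Fin (m + 1) → ℝ}
  {γ : ℝ → Space d} {B : ℝ}

theorem norm_sum_smul_le {w : Fin (m + 1) → ℝ} (hw : w ∈ stdSimplex ℝ (Fin (m + 1)))
    {u : Fin (m + 1) → Space d} (hu : ∀ i, ‖u i‖ ≤ B) : ‖∑ i, w i • u i‖ ≤ B := by
  calc ‖∑ i, w i • u i‖ ≤ ∑ i, w i * B := norm_sum_le_of_le _ fun i _ => by
        rw [norm_smul, Real.norm_of_nonneg (hw.1 i)]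
        exact mul_le_mul_of_nonneg_left (hu i) (hw.1 i)
    _ = B := by rw [← Finset.sum_mul, hw.2, one_mul]

theorem IsTrajectory.intervalIntegrable (hF : ∀ i, Continuous (F i)) (hB : ∀ i x, ‖F i x‖ ≤ B)
    (hv : Measurable v) (hvs : ∀ t, 0 ≤ t → v t ∈ stdSimplex ℝ (Fin (m + 1)))
    (hγ : IsTrajectory F x v γ) {s t : ℝ} (hs : 0 ≤ s) (ht : 0 ≤ t) :
    IntervalIntegrable (fun r => ∑ i, v r i • F i (γ r)) volume s t := by
  have hsub : uIoc s t ⊆ Ici 0 := fun r hr => (le_min hs ht).trans hr.1.le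
  rw [intervalIntegrable_iff]
  have : IsFiniteMeasure (volume.restrict (uIoc s t)) := ⟨by simp [uIoc]⟩
  refine Integrable.of_bound (C := B) ?_ ?_
  · refine Finset.aestronglyMeasurable_fun_sum _ fun i _ => ?_
    have h1 : AEStronglyMeasurable (fun r => v r i) (volume.restrict (uIoc s t)) :=
      ((measurable_pi_apply i).comp hv).aestronglyMeasurable
    have h2 : AEStronglyMeasurable (fun r => F i (γ r)) (volume.restrict (uIoc s t)) :=
      ((hF i).comp_continuousOn (hγ.1.mono hsub)).aestronglyMeasurable measurableSet_uIoc
    exact h1.smul h2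
  · filter_upwards [ae_restrict_mem measurableSet_uIoc] with r hr
    exact norm_sum_smul_le (hvs r (hsub hr)) fun i => hB i _

theorem IsTrajectory.sub_eq (hF : ∀ i, Continuous (F i)) (hB : ∀ i x, ‖F i x‖ ≤ B)
    (hv : Measurable v) (hvs : ∀ t, 0 ≤ t → v t ∈ stdSimplex ℝ (Fin (m + 1)))
    (hγ : IsTrajectory F x v γ) {s t : ℝ} (hs : 0 ≤ s) (ht : 0 ≤ t) :
    γ t - γ s = ∫ r in s..t, ∑ i, v r i • F i (γ r) := by
  rw [hγ.2 t ht, hγ.2 s hs, add_sub_add_left_eq_sub,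
    intervalIntegral.integral_interval_sub_left
      (hγ.intervalIntegrable hF hB hv hvs le_rfl ht)
      (hγ.intervalIntegrable hF hB hv hvs le_rfl hs)]

theorem IsTrajectory.norm_sub_le (hF : ∀ i, Continuous (F i)) (hB : ∀ i x, ‖F i x‖ ≤ B)
    (hv : Measurable v) (hvs : ∀ t, 0 ≤ t → v t ∈ stdSimplex ℝ (Fin (m + 1)))
    (hγ : IsTrajectory F x v γ) {s t : ℝ} (hs : 0 ≤ s) (ht : s ≤ t) :
    ‖γ t - γ s‖ ≤ B * (t - s) := by
  rw [hγ.sub_eq hF hB hv hvs hs (hs.trans ht), ← abs_of_nonneg (sub_nonneg.2 ht)]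
  refine intervalIntegral.norm_integral_le_of_norm_le_const fun r hr => ?_
  rw [uIoc_of_le ht] at hr
  exact norm_sum_smul_le (hvs r (hs.trans hr.1.le)) fun i => hB i _

/-- The growth of the squared distance to a fixed point `p` at which all the fields point away
from `γ t`. -/
theorem IsTrajectory.norm_sub_sq_le (hF : ∀ i, Continuous (F i)) (hB : ∀ i x, ‖F i x‖ ≤ B)
    (hv : Measurable v) (hvs : ∀ t, 0 ≤ t → v t ∈ stdSimplex ℝ (Fin (m + 1)))
    (hγ : IsTrajectory F x v γ) {t z : ℝ} (ht : 0 ≤ t) (htz : t ≤ z) {p : Space d} {K : ℝ}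
    (hK0 : 0 ≤ K) (hK : ∀ i, ∀ s ∈ Icc t z, ‖F i (γ s) - F i p‖ ≤ K * ‖γ s - p‖)
    (hp : ∀ i, inner ℝ (γ t - p) (F i p) ≤ 0) :
    ‖γ z - p‖ ^ 2 ≤ ‖γ t - p‖ ^ 2 + (z - t) * (2 * K * ‖γ t - p‖ ^ 2)
      + (2 * K * ‖γ t - p‖ * B + B ^ 2) * (z - t) ^ 2 := by
  set n := γ t - p with hn
  set w := γ z - γ t with hw
  have hB0 : 0 ≤ B := (norm_nonneg _).trans (hB 0 p)
  have hwB : ‖w‖ ≤ B * (z - t) := hγ.norm_sub_le hF hB hv hvs ht htz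
  -- Compare each field with its value at `p`, whose component along `n` is nonpositive; averaging
  -- over the simplex keeps the bound.
  have pointwise : ∀ s ∈ Icc t z, inner ℝ n (∑ i, v s i • F i (γ s))
      ≤ K * ‖n‖ ^ 2 + K * ‖n‖ * B * (z - t) := by
    intro s hs
    have hvs' := hvs s (ht.trans hs.1)
    have each : ∀ i, inner ℝ n (F i (γ s)) ≤ K * ‖n‖ ^ 2 + K * ‖n‖ * B * (z - t) := by
      intro i
      have h1 : inner ℝ n (F i (γ s)) = inner ℝ n (F i p) + inner ℝ n (F i (γ s) - F i p) := by
        rw [← inner_add_right, add_sub_cancel]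
      have h2 : inner ℝ n (F i (γ s) - F i p) ≤ ‖n‖ * ‖F i (γ s) - F i p‖ :=
        real_inner_le_norm _ _
      have h3 : ‖γ s - p‖ ≤ ‖n‖ + B * (z - t) := by
        have h4 := hγ.norm_sub_le hF hB hv hvs ht hs.1
        have h5 : γ s - p = n + (γ s - γ t) := by rw [hn]; abel
        have h6 : B * (s - t) ≤ B * (z - t) :=
          mul_le_mul_of_nonneg_left (by linarith [hs.2]) hB0
        rw [h5]
        exact (norm_add_le _ _).trans (by linarith)
      have h7 : ‖n‖ * ‖F i (γ s) - F i p‖ ≤ ‖n‖ * (K * (‖n‖ + B * (z - t))) := by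
        gcongr
        exact (hK i s hs).trans (by gcongr)
      have := hp i
      rw [h1]
      linarith
    calc inner ℝ n (∑ i, v s i • F i (γ s)) = ∑ i, v s i * inner ℝ n (F i (γ s)) := by
          simp only [inner_sum, inner_smul_right]
      _ ≤ ∑ i, v s i * (K * ‖n‖ ^ 2 + K * ‖n‖ * B * (z - t)) :=
          Finset.sum_le_sum fun i _ => mul_le_mul_of_nonneg_left (each i) (hvs'.1 i)
      _ = K * ‖n‖ ^ 2 + K * ‖n‖ * B * (z - t) := by rw [← Finset.sum_mul, hvs'.2, one_mul]
  have hint := hγ.intervalIntegrable hF hB hv hvs ht (ht.trans htz)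
  have hinner : inner ℝ n w ≤ (K * ‖n‖ ^ 2 + K * ‖n‖ * B * (z - t)) * (z - t) := by
    have h1 : inner ℝ n w = ∫ s in t..z, inner ℝ n (∑ i, v s i • F i (γ s)) := by
      rw [hw, hγ.sub_eq hF hB hv hvs ht (ht.trans htz)]
      exact ((innerSL ℝ n).intervalIntegral_comp_comm hint).symm
    have h2 : IntervalIntegrable (fun s => inner ℝ n (∑ i, v s i • F i (γ s))) volume t z :=
      ⟨(innerSL ℝ n).integrable_comp hint.1, (innerSL ℝ n).integrable_comp hint.2⟩
    have h3 := intervalIntegral.integral_mono_on htz h2 intervalIntegrable_const pointwise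
    rw [intervalIntegral.integral_const, smul_eq_mul] at h3
    rw [h1]
    linarith
  have hsq : ‖w‖ ^ 2 ≤ (B * (z - t)) ^ 2 := by gcongr
  have hsum : γ z - p = n + w := by rw [hn, hw]; abel
  rw [hsum, norm_add_sq_real]
  linarith

/-- A closed set that is forward invariant under each of the flows of the fields `F i` is forward
invariant under the control system with relaxed controls. -/
theorem IsTrajectory.mem_of_flow_mem (hF : ∀ i, ContDiff ℝ ∞ (F i)) (hB : ∀ i x, ‖F i x‖ ≤ B)
    {A : Set (Space d)} (hA : IsClosed A) (hflow : ∀ i, ∀ y ∈ A, ∀ t, 0 ≤ t → flow (F i) t y ∈ A)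
    (hv : Measurable v) (hvs : ∀ t, 0 ≤ t → v t ∈ stdSimplex ℝ (Fin (m + 1)))
    (hγ : IsTrajectory F x v γ) (hx : x ∈ A) {T : ℝ} (hT : 0 ≤ T) : γ T ∈ A := by
  have hFc : ∀ i, Continuous (F i) := fun i => (hF i).continuous
  have hB0 : 0 ≤ B := (norm_nonneg _).trans (hB 0 x)
  have hγ0 : γ 0 = x := by
    have := hγ.2 0 le_rfl
    rwa [intervalIntegral.integral_same, add_zero] at this
  have hAne : A.Nonempty := ⟨x, hx⟩
  -- Radius `2BT`: the trajectory stays within `BT` of `x ∈ A`, so its nearest points in `A` are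
  -- within another `BT`.
  have hKi : ∀ i, ∃ K, LipschitzOnWith K (F i) (Metric.closedBall x (2 * (B * T))) :=
    fun i => exists_lipschitzOnWith_closedBall (hF i) x _
  choose Ki hKi using hKi
  set K : NNReal := ∑ i, Ki i with hKdef
  have hK : ∀ i, LipschitzOnWith K (F i) (Metric.closedBall x (2 * (B * T))) := fun i =>
    (hKi i).weaken (Finset.single_le_sum (fun _ _ => zero_le) (Finset.mem_univ i))
  have hdist : ∀ t ∈ Icc 0 T, dist (γ t) x ≤ B * T := by
    intro t ht
    have := hγ.norm_sub_le hFc hB hv hvs le_rfl ht.1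
    rw [hγ0, sub_zero, ← dist_eq_norm] at this
    exact this.trans (mul_le_mul_of_nonneg_left ht.2 hB0)
  have hgr := le_gronwallBound_of_liminf_deriv_right_le
    (f := fun t => Metric.infDist (γ t) A ^ 2)
    (f' := fun t => 2 * K * Metric.infDist (γ t) A ^ 2) (δ := 0) (K := 2 * K) (ε := 0)
    (a := 0) (b := T)
    (((Metric.continuous_infDist_pt A).comp_continuousOn
      (hγ.1.mono Icc_subset_Ici_self)).pow 2) ?_
    (by simp only [hγ0, Metric.infDist_zero_of_mem hx]; norm_num)
    (fun t _ => by rw [add_zero]) T ⟨hT, le_rfl⟩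
  · rw [gronwallBound_ε0_δ0] at hgr
    rw [hA.mem_iff_infDist_zero hAne]
    exact pow_eq_zero_iff two_ne_zero |>.1 (le_antisymm hgr (sq_nonneg _))
  -- It remains to bound the lower right Dini derivative of the squared distance. The nearest point
  -- `p` to `γ t` is kept fixed while `z` decreases to `t`.
  intro t ht r hr
  obtain ⟨p, hpA, hp⟩ := hA.exists_infDist_eq_dist hAne (γ t)
  have htx := hdist t (Ico_subset_Icc_self ht)
  have hpx : p ∈ Metric.closedBall x (2 * (B * T)) := by
    have h1 : dist (γ t) p ≤ dist (γ t) x := hp ▸ Metric.infDist_le_dist_of_mem hx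
    have h2 := dist_triangle_left p x (γ t)
    rw [Metric.mem_closedBall]
    linarith
  have hBT : 0 ≤ B * T := mul_nonneg hB0 hT
  have hinner : ∀ i, inner ℝ (γ t - p) (F i p) ≤ 0 := fun i => by
    have hs := flow_spec (hF i) (hB i) p
    refine inner_le_zero_of_infDist_eq_dist hp (η := fun s => flow (F i) s p) ?_ hs.1
      (hflow i p hpA)
    have := hs.2 0
    rwa [hs.1] at this
  set c := 2 * K * ‖γ t - p‖ * B + B ^ 2 with hc
  have hlim : Filter.Tendsto (fun z => 2 * K * ‖γ t - p‖ ^ 2 + c * (z - t)) (𝓝[>] t)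
      (𝓝 (2 * K * ‖γ t - p‖ ^ 2)) := by
    have : Continuous fun z => 2 * K * ‖γ t - p‖ ^ 2 + c * (z - t) := by fun_prop
    have h := this.tendsto t
    rw [sub_self, mul_zero, add_zero] at h
    exact h.mono_left nhdsWithin_le_nhds
  rw [hp, dist_eq_norm] at hr
  refine Filter.Eventually.frequently ?_
  filter_upwards [hlim.eventually (gt_mem_nhds hr), Ioo_mem_nhdsGT ht.2] with z hz htz
  refine lt_of_le_of_lt ?_ hz
  have hzt : 0 < z - t := sub_pos.2 htz.1
  have key := hγ.norm_sub_sq_le hFc hB hv hvs ht.1 htz.1.le K.coe_nonneg (p := p) (fun i s hs => by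
    rw [← dist_eq_norm, ← dist_eq_norm]
    refine (hK i).dist_le_mul _ ?_ _ hpx
    rw [Metric.mem_closedBall]
    linarith [hdist s ⟨ht.1.trans hs.1, hs.2.trans htz.2.le⟩]) hinner
  have hle : Metric.infDist (γ z) A ^ 2 ≤ ‖γ z - p‖ ^ 2 := by
    rw [← dist_eq_norm]
    exact pow_le_pow_left₀ Metric.infDist_nonneg (Metric.infDist_le_dist_of_mem hpA) 2
  rw [inv_mul_le_iff₀ hzt, hp, dist_eq_norm]
  linear_combination hle + key

end Trajectory

/-! ### Propagation of the support of the invariant measure -/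

section Support

variable {F : Fin (m + 1) → Space d → Space d}
  {Q : Space d → Matrix (Fin (m + 1)) (Fin (m + 1)) ℝ} {lam : ℝ}
  {μ : Measure (Space d × Fin (m + 1))}

/-- Starting near `x` with index `i`, a jump time just after `t` followed by the choice of `j` lands
in a given neighborhood of the target with probability at least some `c > 0`. Invariance turns this
into mass at least `c * μ W`. -/
theorem mem_support_of_flow (hF : ∀ i, ContDiff ℝ ∞ (F i)) {B : ℝ} (hB : ∀ i x, ‖F i x‖ ≤ B)
    (hQ : Continuous Q) (hlam : 0 < lam) (hμ : IsInvariantMeasure F Q lam μ)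
    {x : Space d} {i j : Fin (m + 1)} (hx : (x, i) ∈ μ.support) {t : ℝ} (ht : 0 ≤ t)
    (hpos : 0 < Q (flow (F i) t x) i j) : (flow (F i) t x, j) ∈ μ.support := by
  rw [Measure.support_eq_forall_isOpen]
  intro U hxU hU
  obtain ⟨ε, hε, hεQ⟩ := exists_between hpos
  have hN : {y | (y, j) ∈ U} ∩ {y | ε < Q y i j} ∈ 𝓝 (flow (F i) t x) := by
    refine Filter.inter_mem ((hU.preimage (by fun_prop)).mem_nhds hxU) ?_
    exact (isOpen_lt continuous_const (hQ.matrix_elem i j)).mem_nhds hεQ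
  obtain ⟨δ, hδ, hflow⟩ := exists_forall_flow_mem (hF i) (hB i) ht hN
  set c := ENNReal.ofReal ε * expMeasure lam (Ioo t (t + δ)) with hc
  have hc0 : c ≠ 0 := mul_ne_zero (ENNReal.ofReal_pos.2 hε).ne'
    (expMeasure_Ioo_pos hlam ht (by linarith)).ne'
  set W : Set (Space d × Fin (m + 1)) := Metric.ball x δ ×ˢ {i} with hW
  have hWopen : IsOpen W := Metric.isOpen_ball.prod (isOpen_discrete _)
  have hWpos : 0 < μ W := by
    rw [Measure.support_eq_forall_isOpen] at hx
    exact hx W ⟨Metric.mem_ball_self hδ, rfl⟩ hWopen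
  have lower : ∀ z, W.indicator (fun _ => c) z ≤ transitionProb F Q lam z U := by
    rintro ⟨y, k⟩
    by_cases hyk : (y, k) ∈ W
    · obtain ⟨hy, rfl⟩ : y ∈ Metric.ball x δ ∧ k = i := by
        simpa [hW] using hyk
      rw [indicator_of_mem hyk, hc, ← lintegral_indicator_const measurableSet_Ioo]
      refine lintegral_mono fun s => ?_
      by_cases hs : s ∈ Ioo t (t + δ)
      · obtain ⟨h1, h2⟩ := hflow s hs y hy
        have h1' : (flow (F k) s y, j) ∈ U := h1
        have h2' : ε < Q (flow (F k) s y) k j := h2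
        rw [indicator_of_mem hs]
        refine le_trans ?_ (Finset.single_le_sum
          (f := fun l => ENNReal.ofReal (Q (flow (F k) s y) k l) *
            U.indicator 1 (flow (F k) s y, l)) (fun _ _ => zero_le) (Finset.mem_univ j))
        simp only [indicator_of_mem h1', Pi.one_apply, mul_one]
        exact ENNReal.ofReal_le_ofReal h2'.le
      · rw [indicator_of_notMem hs]
        exact zero_le
    · rw [indicator_of_notMem hyk]
      exact zero_le
  rw [← hμ U hU.measurableSet]
  refine lt_of_lt_of_le ?_ (lintegral_mono lower)
  rw [lintegral_indicator_const hWopen.measurableSet]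
  exact pos_iff_ne_zero.2 (mul_ne_zero hc0 hWpos.ne')

/-- Jumps at time `0` have probability zero but are limits of short ones, so the support admits
index changes along positive entries at the fixed point `x`. -/
theorem mem_support_of_mem_support (hF : ∀ i, ContDiff ℝ ∞ (F i)) {B : ℝ}
    (hB : ∀ i x, ‖F i x‖ ≤ B) (hQ : Continuous Q) (hQ' : ∀ x, IsIrreducibleAperiodic (Q x))
    (hlam : 0 < lam) (hμ : IsInvariantMeasure F Q lam μ)
    {x : Space d} {i : Fin (m + 1)} (hx : (x, i) ∈ μ.support) (j : Fin (m + 1)) :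
    (x, j) ∈ μ.support := by
  obtain ⟨hnn, -, n, -, hn⟩ := hQ' x
  suffices h : ∀ k : ℕ, ∀ l, 0 < (Q x ^ k) i l → (x, l) ∈ μ.support from h n j (hn i j)
  intro k
  induction k with
  | zero =>
    intro l hl
    rw [pow_zero, Matrix.one_apply] at hl
    split_ifs at hl with h
    · exact h ▸ hx
    · exact absurd hl (lt_irrefl _)
  | succ k ih =>
    intro l hl
    rw [pow_succ, Matrix.mul_apply] at hl
    obtain ⟨e, -, he⟩ := Finset.exists_lt_of_sum_lt (s := Finset.univ) (f := fun _ => (0 : ℝ))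
      (g := fun e => (Q x ^ k) i e * Q x e l) (by rwa [Finset.sum_const_zero])
    have hel : 0 < Q x e l := lt_of_le_of_ne (hnn e l) fun h => by
      rw [← h, mul_zero] at he
      exact lt_irrefl _ he
    have h0 := (flow_spec (hF e) (hB e) x).1
    have := mem_support_of_flow hF hB hQ hlam hμ (ih e (pos_of_mul_pos_left he hel.le))
      le_rfl (j := l) (by rwa [h0])
    rwa [h0] at this

theorem closure_reach_subset_support (hF : ∀ i, ContDiff ℝ ∞ (F i)) {B : ℝ}
    (hB : ∀ i x, ‖F i x‖ ≤ B) (hQ : Continuous Q) (hQ' : ∀ x, IsIrreducibleAperiodic (Q x))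
    (hlam : 0 < lam) (hμ : IsInvariantMeasure F Q lam μ) {V : Set (Fin (m + 1) → ℝ)}
    (hV : V = vertexSet m ∨ V = stdSimplex ℝ (Fin (m + 1)))
    {x : Space d} {i : Fin (m + 1)} (hx : (x, i) ∈ μ.support) :
    closure (reach F V x) ×ˢ (univ : Set (Fin (m + 1))) ⊆ μ.support := by
  set A : Set (Space d) := {y | (y, i) ∈ μ.support} with hAdef
  have all : ∀ {y k}, (y, k) ∈ μ.support → ∀ l, (y, l) ∈ μ.support := fun h l =>
    mem_support_of_mem_support hF hB hQ hQ' hlam hμ h l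
  have hA : IsClosed A := Measure.isClosed_support.preimage (by fun_prop)
  have hflow : ∀ k, ∀ y ∈ A, ∀ t, 0 ≤ t → flow (F k) t y ∈ A := by
    intro k y hy t ht
    -- The row sums to one, so some index is available after the flow; the index is then switched
    -- back to `i`.
    have hrow := (hQ' (flow (F k) t y)).2.1 k
    obtain ⟨l, -, hl⟩ := Finset.exists_lt_of_sum_lt (s := Finset.univ) (f := fun _ => (0 : ℝ))
      (g := fun l => Q (flow (F k) t y) k l) (by rw [Finset.sum_const_zero, hrow]; exact one_pos)
    exact all (mem_support_of_flow hF hB hQ hlam hμ (all hy k) ht hl) i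
  have hreach : reach F V x ⊆ A := by
    intro y hy
    obtain ⟨T, -, v, γ, hv, hγ, t, ht, rfl⟩ := mem_iUnion₂.1 hy
    exact hγ.mem_of_flow_mem hF hB hA hflow hv.1 (fun s hs => hv.mem_stdSimplex hV hs) hx ht.1
  rintro ⟨y, k⟩ ⟨hy, -⟩
  exact all (closure_minimal hreach hA hy) k

end Support

end PDMP

/-! ### The main theorem -/

theorem mainTheorem3 (d m : ℕ)
    (F : Fin (m + 1) → PDMP.Space d → PDMP.Space d)
    (hF_smooth : ∀ i, ContDiff ℝ ∞ (F i))
    (hF_bdd : ∀ i, ∃ B : ℝ, ∀ x, ‖F i x‖ ≤ B)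
    (Q : PDMP.Space d → Matrix (Fin (m + 1)) (Fin (m + 1)) ℝ)
    (hQ_cont : Continuous Q)
    (hQ : ∀ x, PDMP.IsIrreducibleAperiodic (Q x))
    (lam : ℝ) (hlam : 0 < lam)
    (M : Set (PDMP.Space d)) (hM : IsCompact M)
    (hM_inv : ∀ i, ∀ x ∈ M, ∀ t : ℝ, 0 ≤ t → PDMP.flow (F i) t x ∈ M)
    (μ : Measure (PDMP.Space d × Fin (m + 1))) [IsProbabilityMeasure μ]
    (hμM : μ (M ×ˢ (univ : Set (Fin (m + 1))))ᶜ = 0)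
    (hμ : PDMP.IsInvariantMeasure F Q lam μ)
    (V : Set (Fin (m + 1) → ℝ))
    (hV : V = PDMP.vertexSet m ∨ V = stdSimplex ℝ (Fin (m + 1)))
    (C : Set (PDMP.Space d)) (hC : PDMP.IsInvariantControlSet F V C)
    (hC_compact : IsCompact C)
    (hC_acc : ∀ x ∈ C, PDMP.LocallyAccessibleAt F V x)
    (hsupp : (μ.support ∩ C ×ˢ (univ : Set (Fin (m + 1)))).Nonempty) :
    C ×ˢ (univ : Set (Fin (m + 1))) ⊆ μ.support ∧
      0 < μ (C ×ˢ (univ : Set (Fin (m + 1)))) := by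
  choose Bi hBi using hF_bdd
  have hB : ∀ i x, ‖F i x‖ ≤ ∑ k, |Bi k| := fun i x =>
    ((hBi i x).trans (le_abs_self _)).trans
      (Finset.single_le_sum (f := fun k => |Bi k|) (fun _ _ => abs_nonneg _) (Finset.mem_univ i))
  obtain ⟨⟨x, i⟩, hx, hxC, -⟩ := hsupp
  have hCreach : C = closure (PDMP.reach F V x) := by
    rw [← hC.2 x hxC, hC_compact.isClosed.closure_eq]
  have hsub : C ×ˢ (univ : Set (Fin (m + 1))) ⊆ μ.support := by
    rw [hCreach]
    exact PDMP.closure_reach_subset_support hF_smooth hB hQ_cont hQ hlam hμ hV hx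
  refine ⟨hsub, ?_⟩
  -- Positive mass needs an open neighborhood of a support point inside `C × E`; only the forward
  -- half of accessibility enters.
  obtain ⟨y, hy, -⟩ := (hC_acc x hxC 1 one_pos univ Filter.univ_mem).1
  have hint : interior (PDMP.reachLE F V 1 x) ⊆ C := by
    rw [hCreach]
    exact interior_subset.trans ((subset_biUnion_of_mem (u := fun T => PDMP.reachLE F V T x)
      (mem_Ioi.2 one_pos)).trans subset_closure)
  have hyi : (y, i) ∈ μ.support := hsub ⟨hint hy, mem_univ _⟩
  rw [Measure.mem_support_iff_forall] at hyi
  refine (hyi _ ((isOpen_interior.prod isOpen_univ).mem_nhds ⟨hy, mem_univ i⟩)).trans_le ?_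
  exact measure_mono (prod_mono_left hint)
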